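/- Let $n\ge 2$, $a>1$, $M\in\mathbb R$, and let $\psi(x)=\frac a2 (x_1^+)^2$ on $\mathbb R^n$, where $x_1^+=\max(x_1,0)$. For $w\in C^1(\mathbb R^n)$ put $\Omega(w)=\mathbb R^n\setminus(\{w=0\}\cap\{\nabla w=0\})$, $\Lambda(w)=\mathbb R^n\setminus\Omega(w)$ and $\Gamma(w)=\partial\Lambda(w)$. Let $u\in C^{1,1}_{loc}(\mathbb R^n)$ be a global solution with upper obstacle $\psi$, that is, $$\Delta u=\chi_{\Omega(u)\cap\{u<\psi\}}+a\,\chi_{\Omega(u)\cap\{u=\psi\}}\ \text{ a.e. in }\mathbb R^n,\qquad u\le\psi\ \text{ in }\mathbb R^n,$$ $$\|D^2u\|_{L^\infty(\mathbb R^n)}\le M,\qquad 0\in\Gamma(u)$$ (the obstacle satisfies $\Delta\psi=a\chi_{\Omega(\psi)}$ a.e. in $\mathbb R^n$). Assume moreover that $u$ is a solution of $$\Delta u=\chi_{\{0<u<\psi\}}+\Delta\psi\,\chi_{\{0<u=\psi\}}\quad\text{a.e. in }\mathbb R^n .$$ For $\lambda>0$ let $u_\lambda(x)=\dfrac{u(\lambda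 x)-u(0)}{\lambda^2}$. A function $v\in C^{1,1}_{loc}(\mathbb R^n)$ is called a blowup (respectively a shrink-down) of $u$ at $0$ if there is a sequence $\lambda_j>0$ with $\lambda_j\to0$ (respectively $\lambda_j\to\infty$) such that $u_{\lambda_j}\to v$ in $C^{1,\alpha}_{loc}(\mathbb R^n)$ for every $0<\alpha<1$. Then every blowup $u_0$ of $u$ at $0$ and every shrink-down $u_\infty$ of $u$ at $0$ is homogeneous of degree two: $u_0(\lambda x)=\lambda^2u_0(x)$ and $u_\infty(\lambda x)=\lambda^2u_\infty(x)$ for all $x\in\mathbb R^n$ and all $\lambda>0$. -/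

import Mathlib

open MeasureTheory Filter Set
open scoped ENNReal NNReal Topology Laplacian

namespace DoubleObstacle

variable {n : ℕ}

/-- The class `C^{1,1}_loc(ℝⁿ) = W^{2,∞}_loc(ℝⁿ)`: continuously differentiable functions with locally
Lipschitz gradient. By Rademacher's theorem the gradient of such a function is differentiable almost
everywhere, so its second derivative `fderiv ℝ (fderiv ℝ u)` and its Laplacian `Δ u` exist almost
everywhere, and they are the weak ones. -/
def IsC11Loc (u : EuclideanSpace ℝ (Fin n) → ℝ) : Prop :=
  ContDiff ℝ 1 u ∧ LocallyLipschitz (fderiv ℝ u)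

/-- `Ω(u) = ℝⁿ ∖ ({u = 0} ∩ {∇u = 0})`. -/
def Omega (u : EuclideanSpace ℝ (Fin n) → ℝ) : Set (EuclideanSpace ℝ (Fin n)) :=
  ({x | u x = 0} ∩ {x | fderiv ℝ u x = 0})ᶜ

/-- `Λ(u) = ℝⁿ ∖ Ω(u)`. -/
def Lambda (u : EuclideanSpace ℝ (Fin n) → ℝ) : Set (EuclideanSpace ℝ (Fin n)) := (Omega u)ᶜ

/-- The free boundary `Γ(u) = ∂Λ(u)`. -/
def Gamma (u : EuclideanSpace ℝ (Fin n) → ℝ) : Set (EuclideanSpace ℝ (Fin n)) :=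
  frontier (Lambda u)

/-- The characteristic function `χ_E`. -/
noncomputable def chi (E : Set (EuclideanSpace ℝ (Fin n))) : EuclideanSpace ℝ (Fin n) → ℝ :=
  E.indicator (fun _ => 1)

/-- `u` belongs to the class `P_∞(M)` of global solutions, with the constant `a > 1` and the upper
obstacle `ψ`. -/
structure IsGlobalSolution (a M : ℝ) (ψ u : EuclideanSpace ℝ (Fin n) → ℝ) : Prop where
  one_lt : 1 < a
  obstacle_regular : IsC11Loc ψ
  regular : IsC11Loc u
  equation : ∀ᵐ x, (Δ u) x =
    chi (Omega u ∩ {y | u y < ψ y}) x + a * chi (Omega u ∩ {y | u y = ψ y}) x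
  le_obstacle : ∀ x, u x ≤ ψ x
  obstacle_equation : ∀ᵐ x, (Δ ψ) x = a * chi (Omega ψ) x
  hessian_bound : eLpNorm (fderiv ℝ (fderiv ℝ u)) ∞ volume ≤ ENNReal.ofReal M
  zero_mem : (0 : EuclideanSpace ℝ (Fin n)) ∈ Gamma u

/-- The half-space obstacle `ψ(x) = (a/2) (x₁⁺)²`; the first coordinate `x₁` has index `0`. -/
noncomputable def halfSpaceObstacle [NeZero n] (a : ℝ) : EuclideanSpace ℝ (Fin n) → ℝ :=
  fun x => a / 2 * (max (x 0) 0) ^ 2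

/-- The rescaling `u_{lam, x₀}(x) = (u(x₀ + lam x) - u(x₀)) / lam²`. -/
noncomputable def rescale (u : EuclideanSpace ℝ (Fin n) → ℝ) (x₀ : EuclideanSpace ℝ (Fin n))
    (lam : ℝ) : EuclideanSpace ℝ (Fin n) → ℝ :=
  fun x => (u (x₀ + lam • x) - u x₀) / lam ^ 2

/-- The `C^{1,α}(K)` norm `sup_K |w| + sup_K |∇w| + [∇w]_{α,K}` of a function `w`, with values in
`[0, ∞]`. -/
noncomputable def c1HolderNorm (α : ℝ≥0) (K : Set (EuclideanSpace ℝ (Fin n)))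
    (w : EuclideanSpace ℝ (Fin n) → ℝ) : ℝ≥0∞ :=
  (⨆ x ∈ K, ‖w x‖ₑ) + (⨆ x ∈ K, ‖fderiv ℝ w x‖ₑ) + eHolderNorm α (K.domRestrict (fderiv ℝ w))

/-- Convergence `v_j → v` in `C^{1,α}_loc(ℝⁿ)`. -/
def TendstoC1HolderLoc (α : ℝ≥0) (v : ℕ → EuclideanSpace ℝ (Fin n) → ℝ)
    (v₀ : EuclideanSpace ℝ (Fin n) → ℝ) : Prop :=
  ∀ K : Set (EuclideanSpace ℝ (Fin n)), IsCompact K →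
    Tendsto (fun j => c1HolderNorm α K (v j - v₀)) atTop (𝓝 0)

/-- `v` is a blowup of `u` at `x₀`: a limit in `C^{1,α}_loc(ℝⁿ)`, for every `0 < α < 1`, of
rescalings of `u` at `x₀` along a sequence of positive numbers tending to `0`. -/
def IsBlowup (u : EuclideanSpace ℝ (Fin n) → ℝ) (x₀ : EuclideanSpace ℝ (Fin n))
    (v : EuclideanSpace ℝ (Fin n) → ℝ) : Prop :=
  IsC11Loc v ∧ ∃ lam : ℕ → ℝ, (∀ j, 0 < lam j) ∧ Tendsto lam atTop (𝓝 0) ∧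
    ∀ α : ℝ≥0, 0 < α → α < 1 → TendstoC1HolderLoc α (fun j => rescale u x₀ (lam j)) v

/-- `v` is a shrink-down of `u` at `x₀`: a limit in `C^{1,α}_loc(ℝⁿ)`, for every `0 < α < 1`, of
rescalings of `u` at `x₀` along a sequence of positive numbers tending to `∞`. -/
def IsShrinkDown (u : EuclideanSpace ℝ (Fin n) → ℝ) (x₀ : EuclideanSpace ℝ (Fin n))
    (v : EuclideanSpace ℝ (Fin n) → ℝ) : Prop :=
  IsC11Loc v ∧ ∃ lam : ℕ → ℝ, (∀ j, 0 < lam j) ∧ Tendsto lam atTop atTop ∧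
    ∀ α : ℝ≥0, 0 < α → α < 1 → TendstoC1HolderLoc α (fun j => rescale u x₀ (lam j)) v

/-- `v` is homogeneous of degree two: `v(lam x) = lam² v(x)` for all `x` and all `lam > 0`. -/
def IsHomogeneousDegTwo (v : EuclideanSpace ℝ (Fin n) → ℝ) : Prop :=
  ∀ (x : EuclideanSpace ℝ (Fin n)) (lam : ℝ), 0 < lam → v (lam • x) = lam ^ 2 * v x

end DoubleObstacle

/-! The argument is Weiss monotonicity with the cutoff p = (1 - |x|²)⁺ in place of the unit ball, so
that no boundary integrals occur. Write h = x·∇u - 2u and let W be the energy ∫ (|∇v|² + 2v)p² -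
8v²p. Under the flow v ↦ e^{-2t} v(e^t x) the velocity at t = 0 is h. Integrating by parts with the
field p² h ∇v, where ∇p = -2x in the unit ball, gives W' = ∫ 8h²p + 2p²(1 - Δv)h.

The last term vanishes for the solution. The two equations together force u ≥ 0. Hence ∇u = 0 where
u = 0, and ∇u = ∇ψ where u touches ψ, so h = 0 on both sets because ψ is 2-homogeneous. Elsewhere Δu
= 1 (`IsGlobalSolution.defect_mul_eq_zero`). Thus W is monotone in t.

Since u(0) = 0, blowups and shrink-downs are limits of the flow as t → -∞ or t → ∞. Monotonicity
makes the energy of the limit v the same at all scales. The mean value theorem for u on windows of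
unit length then gives zero defect for v at some scale, as large as desired. So x·∇v = 2v
everywhere, which is Euler's equation (`isHomogeneousDegTwo_of_tendsto`). -/

namespace DoubleObstacle

/-! ### Calculus for locally Lipschitz functions. -/

/-- Local form of Rademacher's theorem. -/
theorem ae_differentiableAt_of_locallyLipschitz {E F : Type*}
    [NormedAddCommGroup E] [NormedSpace ℝ E] [FiniteDimensional ℝ E] [MeasurableSpace E]
    [BorelSpace E] [NormedAddCommGroup F] [NormedSpace ℝ F] [FiniteDimensional ℝ F]
    {μ : Measure E} [μ.IsAddHaarMeasure] {f : E → F} (hf : LocallyLipschitz f) :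
    ∀ᵐ x ∂μ, DifferentiableAt ℝ f x := by
  have h : ∀ k : ℕ, ∀ᵐ x ∂μ, x ∈ Metric.ball (0 : E) k → DifferentiableAt ℝ f x := by
    intro k
    obtain ⟨K, hK⟩ := (hf.locallyLipschitzOn (s := Metric.closedBall (0 : E) k)).exists_lipschitzOnWith_of_compact
      (isCompact_closedBall _ _)
    filter_upwards [(hK.mono Metric.ball_subset_closedBall).ae_differentiableWithinAt_of_mem (μ := μ)] with x hx hxk
    exact (hx hxk).differentiableAt (Metric.isOpen_ball.mem_nhds hxk)
  filter_upwards [ae_all_iff.2 h] with x hx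
  obtain ⟨k, hk⟩ := exists_nat_gt ‖x‖
  exact hx k (by simpa using hk)

/-- A Lipschitz constant C on the compact set [-1,1] × K gives the dominating function C·χ_K. -/
theorem hasDerivAt_integral_of_locallyLipschitz {E : Type*}
    [NormedAddCommGroup E] [NormedSpace ℝ E] [FiniteDimensional ℝ E] [MeasurableSpace E]
    [BorelSpace E] {μ : Measure E} [μ.IsAddHaarMeasure] {F : ℝ × E → ℝ} (hF : LocallyLipschitz F)
    {K : Set E} (hK : IsCompact K) (h0 : ∀ t x, |t| ≤ 1 → x ∉ K → F (t, x) = 0)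
    {F' : E → ℝ} (hF' : ∀ᵐ x ∂μ, HasDerivAt (fun t => F (t, x)) (F' x) 0) :
    Integrable F' μ ∧ HasDerivAt (fun t => ∫ x, F (t, x) ∂μ) (∫ x, F' x ∂μ) 0 := by
  obtain ⟨C, hC⟩ := (hF.locallyLipschitzOn
    (s := Icc (-1 : ℝ) 1 ×ˢ K)).exists_lipschitzOnWith_of_compact (isCompact_Icc.prod hK)
  have hcont : ∀ t, Continuous fun x => F (t, x) := fun t =>
    hF.continuous.comp (by fun_prop)
  have hs : Icc (-1 : ℝ) 1 ∈ 𝓝 (0 : ℝ) := Icc_mem_nhds (by norm_num) (by norm_num)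
  refine hasDerivAt_integral_of_dominated_loc_of_lip (s := Icc (-1 : ℝ) 1)
    (bound := K.indicator fun _ => (C : ℝ)) hs ?_ ?_ ?_ ?_ ?_ hF'
  · exact Eventually.of_forall fun t => (hcont t).aestronglyMeasurable
  · exact (hcont 0).integrable_of_hasCompactSupport
      (HasCompactSupport.intro hK fun x hx => h0 0 x (by simp) hx)
  · have hlim : ∀ᵐ x ∂μ, Tendsto (fun k : ℕ =>
        ((1 : ℝ) / ((k : ℝ) + 1))⁻¹ • (F (0 + 1 / ((k : ℝ) + 1), x) - F (0, x))) atTop (𝓝 (F' x)) := by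
      filter_upwards [hF'] with x hx
      refine hx.tendsto_slope_zero.comp (tendsto_nhdsWithin_iff.2
        ⟨tendsto_one_div_add_atTop_nhds_zero_nat, Eventually.of_forall fun k => ?_⟩)
      simp only [mem_compl_iff, mem_singleton_iff]
      positivity
    refine (aemeasurable_of_tendsto_metrizable_ae' (fun k => ?_) hlim).aestronglyMeasurable
    exact (((hcont _).sub (hcont 0)).const_smul ((1 : ℝ) / ((k : ℝ) + 1))⁻¹).measurable.aemeasurable
  · refine Eventually.of_forall fun x => ?_
    by_cases hx : x ∈ K
    · rw [indicator_of_mem hx]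
      refine LipschitzOnWith.of_dist_le_mul fun s hs t ht => ?_
      have := hC.dist_le_mul (s, x) ⟨hs, hx⟩ (t, x) ⟨ht, hx⟩
      simpa [Prod.dist_eq] using this
    · rw [indicator_of_notMem hx]
      refine LipschitzOnWith.of_dist_le_mul fun s hs t ht => ?_
      rw [h0 s x (abs_le.2 hs) hx, h0 t x (abs_le.2 ht) hx]
      simp
  · exact (integrable_indicator_iff hK.measurableSet).2 (integrableOn_const hK.measure_lt_top.ne)

/-- By translation invariance t ↦ ∫ X(x + tw) is constant; differentiate it at t = 0. This is the
divergence theorem used for the energy. -/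
theorem integral_fderiv_eq_zero {E : Type*}
    [NormedAddCommGroup E] [NormedSpace ℝ E] [FiniteDimensional ℝ E] [MeasurableSpace E]
    [BorelSpace E] {μ : Measure E} [μ.IsAddHaarMeasure] {X : E → ℝ} (hX : LocallyLipschitz X)
    (hc : HasCompactSupport X) (w : E) :
    Integrable (fun x => fderiv ℝ X x w) μ ∧ ∫ x, fderiv ℝ X x w ∂μ = 0 := by
  have h := hasDerivAt_integral_of_locallyLipschitz (μ := μ) (F := fun z : ℝ × E => X (z.2 + z.1 • w))
    (F' := fun x => fderiv ℝ X x w) (K := Metric.cthickening ‖w‖ (tsupport X)) ?_ ?_ ?_ ?_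
  · refine ⟨h.1, h.2.unique ?_⟩
    have : (fun t : ℝ => ∫ x, X (x + t • w) ∂μ) = fun _ => ∫ x, X x ∂μ := by
      funext t
      exact integral_add_right_eq_self X (t • w)
    simpa [this] using hasDerivAt_const (0 : ℝ) (∫ x, X x ∂μ)
  · have h1 : ContDiff ℝ 1 fun z : ℝ × E => z.2 + z.1 • w := by fun_prop
    exact hX.comp h1.locallyLipschitz
  · exact IsCompact.cthickening hc
  · intro t x ht hx
    by_contra hne
    refine hx (Metric.mem_cthickening_of_dist_le x (x + t • w) _ _ (subset_tsupport X hne) ?_)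
    simpa [dist_eq_norm, norm_smul] using mul_le_of_le_one_left (norm_nonneg w) ht
  · filter_upwards [ae_differentiableAt_of_locallyLipschitz (μ := μ) hX] with x hx
    have h1 : HasDerivAt (fun t : ℝ => x + t • w) w 0 := by
      simpa using ((hasDerivAt_id (0 : ℝ)).smul_const w).const_add x
    have h2 : HasFDerivAt X (fderiv ℝ X x) (x + (0 : ℝ) • w) := by simpa using hx.hasFDerivAt
    exact h2.comp_hasDerivAt (0 : ℝ) h1

/-! ### The cutoff. -/

/-- The cutoff function `(1 - |x|²)⁺`. -/
noncomputable def cutoff {n : ℕ} (x : EuclideanSpace ℝ (Fin n)) : ℝ := max (1 - ‖x‖ ^ 2) 0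

/-- Squaring removes the kink of s⁺ at 0. Hence p² is differentiable everywhere, although p is not;
the formula also serves for ψ. -/
theorem hasDerivAt_max_zero_sq (t : ℝ) : HasDerivAt (fun s : ℝ => max s 0 ^ 2) (2 * max t 0) t := by
  rcases lt_trichotomy t 0 with h | h | h
  · rw [max_eq_right h.le, mul_zero]
    refine (hasDerivAt_const t (0 : ℝ)).congr_of_eventuallyEq ?_
    filter_upwards [Iio_mem_nhds h] with s hs
    simp [max_eq_right (mem_Iio.1 hs).le]
  · subst h
    rw [hasDerivAt_iff_isLittleO]
    simp only [max_self, mul_zero, smul_zero, sub_zero, ne_eq, OfNat.ofNat_ne_zero,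
      not_false_eq_true, zero_pow]
    refine Asymptotics.IsBigO.trans_isLittleO (g := fun s : ℝ => s ^ 2) ?_ ?_
    · refine Asymptotics.isBigO_of_le _ fun s => ?_
      rw [Real.norm_eq_abs, Real.norm_eq_abs, abs_pow, abs_pow]
      refine pow_le_pow_left₀ (abs_nonneg _) ?_ 2
      rw [abs_of_nonneg (le_max_right s 0)]
      exact max_le (le_abs_self _) (abs_nonneg _)
    · exact Asymptotics.isLittleO_pow_id one_lt_two
  · rw [max_eq_left h.le]
    refine (((hasDerivAt_id t).pow 2).congr_of_eventuallyEq ?_).congr_deriv (by simp)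
    filter_upwards [Ioi_mem_nhds h] with s hs
    simp [max_eq_left (mem_Ioi.1 hs).le]

variable {n : ℕ}

theorem cutoff_nonneg (x : EuclideanSpace ℝ (Fin n)) : 0 ≤ cutoff x := le_max_right _ _

theorem cutoff_pos {x : EuclideanSpace ℝ (Fin n)} (hx : ‖x‖ < 1) : 0 < cutoff x := by
  refine lt_max_of_lt_left ?_
  nlinarith [norm_nonneg x]

theorem cutoff_eq_zero {x : EuclideanSpace ℝ (Fin n)} (hx : x ∉ Metric.closedBall 0 1) :
    cutoff x = 0 := by
  have hx : 1 < ‖x‖ := by simpa using hx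
  refine max_eq_right ?_
  nlinarith

theorem locallyLipschitz_cutoff : LocallyLipschitz (cutoff (n := n)) := by
  have h : ContDiff ℝ 1 fun x : EuclideanSpace ℝ (Fin n) => 1 - ‖x‖ ^ 2 :=
    contDiff_const.sub (contDiff_norm_sq ℝ)
  exact h.locallyLipschitz.max_const 0

theorem hasFDerivAt_cutoff_sq (x : EuclideanSpace ℝ (Fin n)) :
    HasFDerivAt (fun y : EuclideanSpace ℝ (Fin n) => cutoff y ^ 2)
      ((-(4 * cutoff x)) • innerSL ℝ x) x := by
  have h : HasFDerivAt (fun y : EuclideanSpace ℝ (Fin n) => 1 - ‖y‖ ^ 2)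
      (-(2 • innerSL ℝ x)) x := by
    simpa using ((hasStrictFDerivAt_norm_sq x).hasFDerivAt).const_sub 1
  have := (hasDerivAt_max_zero_sq (1 - ‖x‖ ^ 2)).comp_hasFDerivAt x h
  refine this.congr_fderiv ?_
  ext y
  simp [cutoff]
  ring

/-! ### The localized Weiss energy and the dilation flow. -/

/-- The density of the localized Weiss energy. -/
noncomputable def energyDensity (x : EuclideanSpace ℝ (Fin n)) (y : ℝ)
    (l : EuclideanSpace ℝ (Fin n) →L[ℝ] ℝ) : ℝ :=
  (∑ i, l (EuclideanSpace.single i 1) ^ 2 + 2 * y) * cutoff x ^ 2 - 8 * y ^ 2 * cutoff x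

/-- The density of the dissipation of the localized Weiss energy. -/
noncomputable def defectDensity (x : EuclideanSpace ℝ (Fin n)) (y : ℝ)
    (l : EuclideanSpace ℝ (Fin n) →L[ℝ] ℝ) : ℝ :=
  8 * (l x - 2 * y) ^ 2 * cutoff x

/-- The localized Weiss energy `∫ (|∇v|² + 2v) p² - 8 v² p`, where `p = (1 - |x|²)⁺`. -/
noncomputable def weissEnergy (v : EuclideanSpace ℝ (Fin n) → ℝ) : ℝ :=
  ∫ x, energyDensity x (v x) (fderiv ℝ v x)

/-- The homogeneity defect `∫ 8 (x · ∇v - 2v)² p`, where `p = (1 - |x|²)⁺`. -/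
noncomputable def defect (v : EuclideanSpace ℝ (Fin n) → ℝ) : ℝ :=
  ∫ x, defectDensity x (v x) (fderiv ℝ v x)

/-- The quadratic rescaling by the factor `exp t`. -/
noncomputable def dilate (t : ℝ) (v : EuclideanSpace ℝ (Fin n) → ℝ) :
    EuclideanSpace ℝ (Fin n) → ℝ :=
  fun x => Real.exp (-2 * t) * v (Real.exp t • x)

theorem dilate_add (s t : ℝ) (v : EuclideanSpace ℝ (Fin n) → ℝ) :
    dilate (s + t) v = dilate s (dilate t v) := by
  funext x
  simp only [dilate, smul_smul, ← mul_assoc, ← Real.exp_add]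
  congr 2
  · ring_nf
  · rw [add_comm]

theorem fderiv_dilate {v : EuclideanSpace ℝ (Fin n) → ℝ} (hv : Differentiable ℝ v) (t : ℝ)
    (x : EuclideanSpace ℝ (Fin n)) :
    fderiv ℝ (dilate t v) x = Real.exp (-t) • fderiv ℝ v (Real.exp t • x) := by
  have h1 : HasFDerivAt (fun y : EuclideanSpace ℝ (Fin n) => Real.exp t • y)
      (Real.exp t • ContinuousLinearMap.id ℝ _) x := (hasFDerivAt_id x).fun_const_smul _
  have h2 := ((hv (Real.exp t • x)).hasFDerivAt.comp x h1).const_mul (Real.exp (-2 * t))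
  refine h2.fderiv.trans ?_
  ext y
  have : Real.exp (-2 * t) * Real.exp t = Real.exp (-t) := by
    rw [← Real.exp_add]; ring_nf
  simp [← mul_assoc, ← this]

theorem laplacian_eq_sum_fderiv_fderiv (v : EuclideanSpace ℝ (Fin n) → ℝ)
    (x : EuclideanSpace ℝ (Fin n)) :
    (Δ v) x = ∑ i, fderiv ℝ (fderiv ℝ v) x (EuclideanSpace.single i 1)
      (EuclideanSpace.single i 1) := by
  rw [InnerProductSpace.laplacian_eq_iteratedFDeriv_orthonormalBasis v
    (EuclideanSpace.basisFun (Fin n) ℝ)]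
  simp [iteratedFDeriv_two_apply]

theorem clm_eq_sum_single (l : EuclideanSpace ℝ (Fin n) →L[ℝ] ℝ) (x : EuclideanSpace ℝ (Fin n)) :
    l x = ∑ i, x i * l (EuclideanSpace.single i 1) := by
  conv_lhs => rw [← (EuclideanSpace.basisFun (Fin n) ℝ).sum_repr x]
  simp [map_sum]

theorem locallyLipschitz_energyDensity_dilate {v : EuclideanSpace ℝ (Fin n) → ℝ} (hv : IsC11Loc v) :
    LocallyLipschitz fun z : ℝ × EuclideanSpace ℝ (Fin n) =>
      energyDensity z.2 (dilate z.1 v z.2) (fderiv ℝ (dilate z.1 v) z.2) := by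
  have hd : Differentiable ℝ v := hv.1.differentiable one_ne_zero
  have h1 : LocallyLipschitz fun z : ℝ × EuclideanSpace ℝ (Fin n) => Real.exp z.1 • z.2 := by
    have : ContDiff ℝ 1 fun z : ℝ × EuclideanSpace ℝ (Fin n) => Real.exp z.1 • z.2 := by fun_prop
    exact this.locallyLipschitz
  have hfst : LocallyLipschitz fun z : ℝ × EuclideanSpace ℝ (Fin n) => z.1 :=
    LipschitzWith.prod_fst.locallyLipschitz
  have hsnd : LocallyLipschitz fun z : ℝ × EuclideanSpace ℝ (Fin n) => z.2 :=
    LipschitzWith.prod_snd.locallyLipschitz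
  -- The density is a smooth function of t, p(x), v(e^t x) and ∇v(e^t x), all locally Lipschitz in
  -- (t, x).
  have hP : ContDiff ℝ 1 fun w : ℝ × ℝ × ℝ × (EuclideanSpace ℝ (Fin n) →L[ℝ] ℝ) =>
      (∑ i, (Real.exp (-w.1) * w.2.2.2 (EuclideanSpace.single i 1)) ^ 2
        + 2 * (Real.exp (-2 * w.1) * w.2.2.1)) * w.2.1 ^ 2
        - 8 * (Real.exp (-2 * w.1) * w.2.2.1) ^ 2 * w.2.1 := by
    fun_prop
  have hG := hP.locallyLipschitz.comp (hfst.prodMk ((locallyLipschitz_cutoff.comp hsnd).prodMk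
    ((hv.1.locallyLipschitz.comp h1).prodMk (hv.2.comp h1))))
  convert hG using 2 with z
  simp [energyDensity, fderiv_dilate hd, dilate]

/-! ### First variation of the energy along the flow. -/

/-- The vector field `p² (x · ∇v - 2v) ∇v`, where `p = (1 - |x|²)⁺`. -/
noncomputable def radialField (v : EuclideanSpace ℝ (Fin n) → ℝ) (i : Fin n)
    (x : EuclideanSpace ℝ (Fin n)) : ℝ :=
  cutoff x ^ 2 * (fderiv ℝ v x x - 2 * v x) * fderiv ℝ v x (EuclideanSpace.single i 1)

theorem locallyLipschitz_radialField {v : EuclideanSpace ℝ (Fin n) → ℝ} (hv : IsC11Loc v)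
    (i : Fin n) : LocallyLipschitz (radialField v i) := by
  have hP : ContDiff ℝ 1 fun w : ℝ × EuclideanSpace ℝ (Fin n) × ℝ ×
      (EuclideanSpace ℝ (Fin n) →L[ℝ] ℝ) =>
      w.1 ^ 2 * (w.2.2.2 w.2.1 - 2 * w.2.2.1) * w.2.2.2 (EuclideanSpace.single i 1) := by
    fun_prop
  have hG := locallyLipschitz_cutoff.prodMk ((LocallyLipschitz.id
    (α := EuclideanSpace ℝ (Fin n))).prodMk (hv.1.locallyLipschitz.prodMk hv.2))
  have := hP.locallyLipschitz.comp hG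
  exact this

theorem hasCompactSupport_radialField (v : EuclideanSpace ℝ (Fin n) → ℝ) (i : Fin n) :
    HasCompactSupport (radialField v i) :=
  HasCompactSupport.intro (isCompact_closedBall 0 1) fun x hx => by
    simp [radialField, cutoff_eq_zero hx]

theorem fderiv_radialField {v : EuclideanSpace ℝ (Fin n) → ℝ} (hd : Differentiable ℝ v)
    {x : EuclideanSpace ℝ (Fin n)} (hx : DifferentiableAt ℝ (fderiv ℝ v) x) (i : Fin n) :
    fderiv ℝ (radialField v i) x (EuclideanSpace.single i 1) =
      -(4 * cutoff x) * x i * (fderiv ℝ v x x - 2 * v x) * fderiv ℝ v x (EuclideanSpace.single i 1)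
      + cutoff x ^ 2 * (fderiv ℝ (fderiv ℝ v) x (EuclideanSpace.single i 1) x
          - fderiv ℝ v x (EuclideanSpace.single i 1)) * fderiv ℝ v x (EuclideanSpace.single i 1)
      + cutoff x ^ 2 * (fderiv ℝ v x x - 2 * v x) *
          fderiv ℝ (fderiv ℝ v) x (EuclideanSpace.single i 1) (EuclideanSpace.single i 1) := by
  have h1 := ((hasFDerivAt_cutoff_sq x).mul ((hx.hasFDerivAt.clm_apply (hasFDerivAt_id x)).sub
    ((hd x).hasFDerivAt.const_mul 2))).mul
    (hx.hasFDerivAt.clm_apply (hasFDerivAt_const (EuclideanSpace.single i (1 : ℝ)) x))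
  rw [show fderiv ℝ (radialField v i) x = _ from h1.fderiv]
  simp [EuclideanSpace.inner_single_right]
  ring

theorem fderiv_fderiv_symm {v : EuclideanSpace ℝ (Fin n) → ℝ} (hd : Differentiable ℝ v)
    {x : EuclideanSpace ℝ (Fin n)} (hx : DifferentiableAt ℝ (fderiv ℝ v) x)
    (w w' : EuclideanSpace ℝ (Fin n)) :
    fderiv ℝ (fderiv ℝ v) x w w' = fderiv ℝ (fderiv ℝ v) x w' w :=
  second_derivative_symmetric_of_eventually
    (Eventually.of_forall fun y => (hd y).hasFDerivAt) hx.hasFDerivAt w w'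

theorem sum_fderiv_radialField {v : EuclideanSpace ℝ (Fin n) → ℝ} (hd : Differentiable ℝ v)
    {x : EuclideanSpace ℝ (Fin n)} (hx : DifferentiableAt ℝ (fderiv ℝ v) x) :
    ∑ i, fderiv ℝ (radialField v i) x (EuclideanSpace.single i 1) =
      -(4 * cutoff x) * (fderiv ℝ v x x - 2 * v x) * fderiv ℝ v x x
      + cutoff x ^ 2 * (∑ i, fderiv ℝ v x (EuclideanSpace.single i 1) *
          (fderiv ℝ (fderiv ℝ v) x x (EuclideanSpace.single i 1)
            - fderiv ℝ v x (EuclideanSpace.single i 1)))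
      + cutoff x ^ 2 * (fderiv ℝ v x x - 2 * v x) * (Δ v) x := by
  have h1 : -(4 * cutoff x) * (fderiv ℝ v x x - 2 * v x) * fderiv ℝ v x x =
      ∑ i, -(4 * cutoff x) * (fderiv ℝ v x x - 2 * v x) *
        (x i * fderiv ℝ v x (EuclideanSpace.single i 1)) := by
    rw [← Finset.mul_sum, ← clm_eq_sum_single]
  rw [laplacian_eq_sum_fderiv_fderiv, h1, Finset.mul_sum, Finset.mul_sum,
    ← Finset.sum_add_distrib, ← Finset.sum_add_distrib]
  refine Finset.sum_congr rfl fun i _ => ?_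
  -- Symmetry of D²v turns the divergence terms D²v(eᵢ, x) into D²v(x, eᵢ), the form produced by
  -- differentiating along the dilation.
  rw [fderiv_radialField hd hx, fderiv_fderiv_symm hd hx x]
  ring

theorem hasDerivAt_energyDensity_dilate {v : EuclideanSpace ℝ (Fin n) → ℝ}
    (hd : Differentiable ℝ v) {x : EuclideanSpace ℝ (Fin n)}
    (hx : DifferentiableAt ℝ (fderiv ℝ v) x) :
    HasDerivAt (fun t => energyDensity x (dilate t v x) (fderiv ℝ (dilate t v) x))
      (2 * cutoff x ^ 2 * ((∑ i, fderiv ℝ v x (EuclideanSpace.single i 1) *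
          (fderiv ℝ (fderiv ℝ v) x x (EuclideanSpace.single i 1)
            - fderiv ℝ v x (EuclideanSpace.single i 1))) + (fderiv ℝ v x x - 2 * v x))
        - 16 * v x * (fderiv ℝ v x x - 2 * v x) * cutoff x) 0 := by
  have hpath : HasDerivAt (fun t : ℝ => Real.exp t • x) x 0 := by
    simpa using (Real.hasDerivAt_exp 0).smul_const x
  have hval : HasDerivAt (fun t => v (Real.exp t • x)) (fderiv ℝ v x x) 0 := by
    have h2 : HasFDerivAt v (fderiv ℝ v x) (Real.exp 0 • x) := by simpa using (hd x).hasFDerivAt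
    exact h2.comp_hasDerivAt (0 : ℝ) hpath
  have hgrad : ∀ i, HasDerivAt
      (fun t => fderiv ℝ v (Real.exp t • x) (EuclideanSpace.single i (1 : ℝ)))
      (fderiv ℝ (fderiv ℝ v) x x (EuclideanSpace.single i (1 : ℝ))) 0 := by
    intro i
    have h2 : HasFDerivAt (fderiv ℝ v) (fderiv ℝ (fderiv ℝ v) x) (Real.exp 0 • x) := by
      simpa using hx.hasFDerivAt
    have h3 : HasDerivAt (fun t : ℝ => fderiv ℝ v (Real.exp t • x))
        (fderiv ℝ (fderiv ℝ v) x x) 0 := h2.comp_hasDerivAt (0 : ℝ) hpath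
    have h4 := h3.clm_apply (hasDerivAt_const (0 : ℝ) (EuclideanSpace.single i (1 : ℝ)))
    simpa using h4
  have he1 : HasDerivAt (fun t : ℝ => Real.exp (-t)) (-1) 0 := by
    simpa using (hasDerivAt_id (0 : ℝ)).neg.exp
  have he2 : HasDerivAt (fun t : ℝ => Real.exp (-2 * t)) (-2) 0 := by
    simpa using ((hasDerivAt_id (0 : ℝ)).const_mul (-2)).exp
  have hv2 : HasDerivAt (fun t => dilate t v x) (fderiv ℝ v x x - 2 * v x) 0 :=
    (he2.mul hval).congr_deriv (by simp; ring)
  have hg2 : ∀ i, HasDerivAt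
      (fun t => fderiv ℝ (dilate t v) x (EuclideanSpace.single i (1 : ℝ)) ^ 2)
      (2 * (fderiv ℝ v x (EuclideanSpace.single i 1) *
          (fderiv ℝ (fderiv ℝ v) x x (EuclideanSpace.single i 1)
            - fderiv ℝ v x (EuclideanSpace.single i 1)))) 0 := by
    intro i
    simp only [fderiv_dilate hd, smul_apply, smul_eq_mul]
    exact ((he1.fun_mul (hgrad i)).fun_pow 2).congr_deriv (by simp; ring)
  have h0 : dilate 0 v x = v x := by simp [dilate]
  refine ((((HasDerivAt.fun_sum (u := Finset.univ) fun i _ => hg2 i).fun_add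
    (hv2.const_mul 2)).mul_const (cutoff x ^ 2)).fun_sub
    (((hv2.fun_pow 2).const_mul 8).mul_const (cutoff x))).congr_deriv ?_
  rw [h0, ← Finset.mul_sum]
  simp
  ring

/-- Pointwise, the derivative of the density is the defect density plus twice the divergence of the
radial field plus 2p²(1 - Δv)(x·∇v - 2v). The last term is zero by `hq`, and the divergence
integrates to zero. -/
theorem hasDerivAt_weissEnergy_dilate_zero {v : EuclideanSpace ℝ (Fin n) → ℝ} (hv : IsC11Loc v)
    (hq : ∀ᵐ x, (1 - (Δ v) x) * (fderiv ℝ v x x - 2 * v x) = 0) :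
    HasDerivAt (fun t => weissEnergy (dilate t v)) (defect v) 0 := by
  have hd : Differentiable ℝ v := hv.1.differentiable one_ne_zero
  have hXint := fun i => integral_fderiv_eq_zero (μ := volume) (locallyLipschitz_radialField hv i)
    (hasCompactSupport_radialField v i) (EuclideanSpace.single i 1)
  have hF := hasDerivAt_integral_of_locallyLipschitz (μ := volume)
    (locallyLipschitz_energyDensity_dilate hv)
    (isCompact_closedBall (0 : EuclideanSpace ℝ (Fin n)) 1)
    (fun t x _ hx => by simp [energyDensity, cutoff_eq_zero hx])
    (F' := fun x => defectDensity x (v x) (fderiv ℝ v x) +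
      2 * ∑ i, fderiv ℝ (radialField v i) x (EuclideanSpace.single i 1)) ?_
  · have hsum : Integrable
        (fun x => 2 * ∑ i, fderiv ℝ (radialField v i) x (EuclideanSpace.single i 1)) volume :=
      (integrable_finsetSum _ fun i _ => (hXint i).1).const_mul 2
    have hdef : Integrable (fun x => defectDensity x (v x) (fderiv ℝ v x)) volume := by
      refine (hF.1.sub hsum).congr (Eventually.of_forall fun x => ?_)
      simp
    refine hF.2.congr_deriv ?_
    rw [integral_add hdef hsum, integral_const_mul, integral_finsetSum _ fun i _ => (hXint i).1]
    simp [(hXint _).2, defect]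
  · filter_upwards [ae_differentiableAt_of_locallyLipschitz (μ := volume) hv.2, hq] with x hx hqx
    refine (hasDerivAt_energyDensity_dilate hd hx).congr_deriv ?_
    rw [sum_fderiv_radialField hd hx, defectDensity]
    linear_combination (2 * cutoff x ^ 2) * hqx

/-! ### Monotonicity at all scales. -/

theorem ae_comp_smul {P : EuclideanSpace ℝ (Fin n) → Prop} (h : ∀ᵐ x, P x) {c : ℝ} (hc : c ≠ 0) :
    ∀ᵐ x : EuclideanSpace ℝ (Fin n), P (c • x) := by
  rw [ae_iff] at h ⊢
  have := Measure.addHaar_preimage_smul (volume : Measure (EuclideanSpace ℝ (Fin n))) hc {x | ¬ P x}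
  rw [h, mul_zero] at this
  exact this

theorem fderiv_dilate_eq {v : EuclideanSpace ℝ (Fin n) → ℝ} (hv : Differentiable ℝ v) (t : ℝ) :
    fderiv ℝ (dilate t v) = fun x => Real.exp (-t) • fderiv ℝ v (Real.exp t • x) :=
  funext fun x => fderiv_dilate hv t x

theorem IsC11Loc.dilate {v : EuclideanSpace ℝ (Fin n) → ℝ} (hv : IsC11Loc v) (t : ℝ) :
    IsC11Loc (dilate t v) := by
  refine ⟨contDiff_const.mul (hv.1.comp (contDiff_const_smul _)), ?_⟩
  rw [fderiv_dilate_eq (hv.1.differentiable one_ne_zero)]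
  exact (lipschitzWith_smul (Real.exp (-t))).locallyLipschitz.comp
    (hv.2.comp (lipschitzWith_smul (Real.exp t)).locallyLipschitz)

theorem laplacian_dilate {v : EuclideanSpace ℝ (Fin n) → ℝ} (hv : Differentiable ℝ v) (t : ℝ)
    (x : EuclideanSpace ℝ (Fin n)) : (Δ (dilate t v)) x = (Δ v) (Real.exp t • x) := by
  have h : fderiv ℝ (fun y => Real.exp (-t) • fderiv ℝ v (Real.exp t • y)) x =
      fderiv ℝ (fderiv ℝ v) (Real.exp t • x) := by
    refine (congrFun (fderiv_const_smul_field (𝕜 := ℝ)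
      (f := fun y => fderiv ℝ v (Real.exp t • y)) (Real.exp (-t))) x).trans ?_
    rw [Pi.smul_apply, fderiv_comp_smul, smul_smul, ← Real.exp_add]
    simp
  rw [laplacian_eq_sum_fderiv_fderiv, laplacian_eq_sum_fderiv_fderiv, fderiv_dilate_eq hv, h]

theorem fderiv_dilate_apply_self {v : EuclideanSpace ℝ (Fin n) → ℝ} (hv : Differentiable ℝ v)
    (t : ℝ) (x : EuclideanSpace ℝ (Fin n)) :
    fderiv ℝ (dilate t v) x x - 2 * dilate t v x = Real.exp (-2 * t) *
      (fderiv ℝ v (Real.exp t • x) (Real.exp t • x) - 2 * v (Real.exp t • x)) := by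
  have : Real.exp (-2 * t) * Real.exp t = Real.exp (-t) := by
    rw [← Real.exp_add]; ring_nf
  rw [fderiv_dilate hv, dilate, ← this]
  simp
  ring

/-- The condition `hq` is scale invariant: a dilation transports Δv unchanged and multiplies x·∇v -
2v by e^{-2t}. As dilations form a one-parameter group, the case t = 0 suffices. -/
theorem hasDerivAt_weissEnergy_dilate {v : EuclideanSpace ℝ (Fin n) → ℝ} (hv : IsC11Loc v)
    (hq : ∀ᵐ x, (1 - (Δ v) x) * (fderiv ℝ v x x - 2 * v x) = 0) (t : ℝ) :
    HasDerivAt (fun t => weissEnergy (dilate t v)) (defect (dilate t v)) t := by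
  have hd : Differentiable ℝ v := hv.1.differentiable one_ne_zero
  have h := hasDerivAt_weissEnergy_dilate_zero (hv.dilate t) (by
    filter_upwards [ae_comp_smul hq (Real.exp_pos t).ne'] with x hx
    rw [laplacian_dilate hd, fderiv_dilate_apply_self hd]
    linear_combination Real.exp (-2 * t) * hx)
  have h0 : t - t = 0 := sub_self t
  rw [← h0] at h
  simpa [← dilate_add] using HasDerivAt.comp_sub_const t t h

theorem defect_nonneg (v : EuclideanSpace ℝ (Fin n) → ℝ) : 0 ≤ defect v :=
  integral_nonneg fun x => mul_nonneg (by positivity) (cutoff_nonneg x)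

theorem monotone_weissEnergy_dilate {v : EuclideanSpace ℝ (Fin n) → ℝ} (hv : IsC11Loc v)
    (hq : ∀ᵐ x, (1 - (Δ v) x) * (fderiv ℝ v x x - 2 * v x) = 0) :
    Monotone fun t => weissEnergy (dilate t v) := by
  refine monotone_of_deriv_nonneg
    (fun t => (hasDerivAt_weissEnergy_dilate hv hq t).differentiableAt) fun t => ?_
  rw [(hasDerivAt_weissEnergy_dilate hv hq t).deriv]
  exact defect_nonneg _

/-! ### Passing to the limit in the energy and the defect. -/

/-- Locally uniform convergence of functions and of their derivatives, tested on balls. -/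
def TendstoC1Loc (w : ℕ → EuclideanSpace ℝ (Fin n) → ℝ) (v : EuclideanSpace ℝ (Fin n) → ℝ) : Prop :=
  ∀ R, TendstoUniformlyOn w v atTop (Metric.closedBall 0 R) ∧
    TendstoUniformlyOn (fun j => fderiv ℝ (w j)) (fderiv ℝ v) atTop (Metric.closedBall 0 R)

theorem TendstoC1Loc.subseq {w : ℕ → EuclideanSpace ℝ (Fin n) → ℝ}
    {v : EuclideanSpace ℝ (Fin n) → ℝ} (h : TendstoC1Loc w v) {k : ℕ → ℕ} (hk : StrictMono k) :
    TendstoC1Loc (fun j => w (k j)) v := fun R =>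
  ⟨fun U hU => hk.tendsto_atTop.eventually ((h R).1 U hU),
    fun U hU => hk.tendsto_atTop.eventually ((h R).2 U hU)⟩

theorem tendstoUniformlyOn_of_tendsto_iSup_enorm {E F : Type*} [NormedAddCommGroup F]
    {f : ℕ → E → F} {g : E → F} {K : Set E}
    (h : Tendsto (fun j => ⨆ x ∈ K, ‖f j x - g x‖ₑ) atTop (𝓝 0)) :
    TendstoUniformlyOn f g atTop K := by
  rw [EMetric.tendstoUniformlyOn_iff]
  intro ε hε
  filter_upwards [h.eventually (gt_mem_nhds hε)] with j hj x hx
  rw [edist_comm, edist_eq_enorm_sub]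
  exact (le_iSup₂ (f := fun x (_ : x ∈ K) => ‖f j x - g x‖ₑ) x hx).trans_lt hj

theorem TendstoC1HolderLoc.tendstoC1Loc {α : ℝ≥0} {w : ℕ → EuclideanSpace ℝ (Fin n) → ℝ}
    {v : EuclideanSpace ℝ (Fin n) → ℝ} (h : TendstoC1HolderLoc α w v)
    (hw : ∀ j, Differentiable ℝ (w j)) (hv : Differentiable ℝ v) : TendstoC1Loc w v := by
  intro R
  have hK := h (Metric.closedBall 0 R) (isCompact_closedBall _ _)
  constructor
  · refine tendstoUniformlyOn_of_tendsto_iSup_enorm (tendsto_of_tendsto_of_tendsto_of_le_of_le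
      tendsto_const_nhds hK (fun _ => zero_le) fun j => ?_)
    exact le_add_right le_self_add
  · refine tendstoUniformlyOn_of_tendsto_iSup_enorm (tendsto_of_tendsto_of_tendsto_of_le_of_le
      tendsto_const_nhds hK (fun _ => zero_le) fun j => ?_)
    refine le_trans (le_of_eq ?_) (le_add_right (le_add_self (α := ℝ≥0∞)))
    simp only [fderiv_sub (hw j _) (hv _)]

/-- Dominated convergence on the unit ball. The scale may vary with j, since the defect is later
evaluated at times supplied by the mean value theorem. -/
theorem tendsto_integral_dilate {Φ : EuclideanSpace ℝ (Fin n) × ℝ ×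
      (EuclideanSpace ℝ (Fin n) →L[ℝ] ℝ) → ℝ} (hΦ : Continuous Φ)
    (h0 : ∀ x y l, x ∉ Metric.closedBall 0 1 → Φ (x, y, l) = 0)
    {w : ℕ → EuclideanSpace ℝ (Fin n) → ℝ} {v : EuclideanSpace ℝ (Fin n) → ℝ}
    (hwv : TendstoC1Loc w v) (hw : ∀ j, ContDiff ℝ 1 (w j)) (hv : ContDiff ℝ 1 v)
    {s : ℕ → ℝ} {s₀ : ℝ} (hs : Tendsto s atTop (𝓝 s₀)) :
    Tendsto (fun j => ∫ x, Φ (x, dilate (s j) (w j) x, fderiv ℝ (dilate (s j) (w j)) x)) atTop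
      (𝓝 (∫ x, Φ (x, dilate s₀ v x, fderiv ℝ (dilate s₀ v) x))) := by
  have hwd := fun j => (hw j).differentiable one_ne_zero
  have hvd := hv.differentiable one_ne_zero
  have hcv : Continuous (fderiv ℝ v) := hv.continuous_fderiv one_ne_zero
  simp only [fderiv_dilate (hwd _), fderiv_dilate hvd, dilate]
  have hse : Tendsto (fun j => Real.exp (s j)) atTop (𝓝 (Real.exp s₀)) :=
    (Real.continuous_exp.tendsto _).comp hs
  have hse1 : Tendsto (fun j => Real.exp (-s j)) atTop (𝓝 (Real.exp (-s₀))) :=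
    (Real.continuous_exp.tendsto _).comp hs.neg
  have hse2 : Tendsto (fun j => Real.exp (-2 * s j)) atTop (𝓝 (Real.exp (-2 * s₀))) :=
    (Real.continuous_exp.tendsto _).comp (hs.const_mul _)
  -- The slack 1 keeps e^{s_j} x in one fixed ball for all large j and all x in the unit ball.
  set R := Real.exp s₀ + 1 with hR
  have hsR : ∀ᶠ j in atTop, Real.exp (s j) ≤ R := by
    filter_upwards [hse.eventually (gt_mem_nhds (lt_add_one _))] with j hj using hj.le
  have hE1 : ∀ᶠ j in atTop, Real.exp (-s j) ≤ Real.exp (-s₀) + 1 := by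
    filter_upwards [hse1.eventually (gt_mem_nhds (lt_add_one _))] with j hj using hj.le
  have hE2 : ∀ᶠ j in atTop, Real.exp (-2 * s j) ≤ Real.exp (-2 * s₀) + 1 := by
    filter_upwards [hse2.eventually (gt_mem_nhds (lt_add_one _))] with j hj using hj.le
  have hball : ∀ {r : ℝ} {x : EuclideanSpace ℝ (Fin n)}, 0 ≤ r → r ≤ R →
      x ∈ Metric.closedBall (0 : EuclideanSpace ℝ (Fin n)) 1 →
      r • x ∈ Metric.closedBall (0 : EuclideanSpace ℝ (Fin n)) R := by
    intro r x hr hrR hx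
    rw [mem_closedBall_zero_iff] at hx ⊢
    rw [norm_smul, Real.norm_of_nonneg hr]
    nlinarith [norm_nonneg x]
  obtain ⟨C₁, hC₁⟩ := (isCompact_closedBall (0 : EuclideanSpace ℝ (Fin n)) R).exists_bound_of_continuousOn
    hv.continuous.continuousOn
  obtain ⟨C₂, hC₂⟩ := (isCompact_closedBall (0 : EuclideanSpace ℝ (Fin n)) R).exists_bound_of_continuousOn
    hcv.continuousOn
  have hb1 : ∀ᶠ j in atTop, ∀ y ∈ Metric.closedBall (0 : EuclideanSpace ℝ (Fin n)) R,
      ‖w j y‖ ≤ C₁ + 1 := by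
    filter_upwards [Metric.tendstoUniformlyOn_iff.1 (hwv R).1 1 one_pos] with j hj y hy
    have := hj y hy
    rw [dist_comm, dist_eq_norm] at this
    linarith [hC₁ y hy, norm_le_norm_add_norm_sub' (w j y) (v y)]
  have hb2 : ∀ᶠ j in atTop, ∀ y ∈ Metric.closedBall (0 : EuclideanSpace ℝ (Fin n)) R,
      ‖fderiv ℝ (w j) y‖ ≤ C₂ + 1 := by
    filter_upwards [Metric.tendstoUniformlyOn_iff.1 (hwv R).2 1 one_pos] with j hj y hy
    have := hj y hy
    rw [dist_comm, dist_eq_norm] at this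
    linarith [hC₂ y hy, norm_le_norm_add_norm_sub' (fderiv ℝ (w j) y) (fderiv ℝ v y)]
  have : ProperSpace (EuclideanSpace ℝ (Fin n) →L[ℝ] ℝ) := FiniteDimensional.proper_real _
  obtain ⟨C, hC⟩ := ((isCompact_closedBall (0 : EuclideanSpace ℝ (Fin n)) 1).prod
    ((isCompact_closedBall (0 : ℝ) ((Real.exp (-2 * s₀) + 1) * (C₁ + 1))).prod
    (isCompact_closedBall (0 : EuclideanSpace ℝ (Fin n) →L[ℝ] ℝ)
      ((Real.exp (-s₀) + 1) * (C₂ + 1))))).exists_bound_of_continuousOn hΦ.continuousOn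
  refine tendsto_integral_filter_of_dominated_convergence
    ((Metric.closedBall (0 : EuclideanSpace ℝ (Fin n)) 1).indicator fun _ => C) ?_ ?_ ?_ ?_
  · refine Eventually.of_forall fun j => Continuous.aestronglyMeasurable ?_
    have := (hw j).continuous
    have := (hw j).continuous_fderiv one_ne_zero
    fun_prop
  · filter_upwards [hsR, hE1, hE2, hb1, hb2] with j h1 h2 h3 h4 h5
    refine Eventually.of_forall fun x => ?_
    by_cases hx : x ∈ Metric.closedBall (0 : EuclideanSpace ℝ (Fin n)) 1
    · rw [indicator_of_mem hx]
      have hy := hball (Real.exp_pos (s j)).le h1 hx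
      refine hC _ ⟨hx, ?_, ?_⟩
      · rw [mem_closedBall_zero_iff, norm_mul, Real.norm_of_nonneg (Real.exp_pos _).le]
        exact mul_le_mul h3 (h4 _ hy) (norm_nonneg _) (by positivity)
      · rw [mem_closedBall_zero_iff, norm_smul, Real.norm_of_nonneg (Real.exp_pos _).le]
        exact mul_le_mul h2 (h5 _ hy) (norm_nonneg _) (by positivity)
    · rw [indicator_of_notMem hx, h0 _ _ _ hx, norm_zero]
  · exact (integrable_indicator_iff Metric.isClosed_closedBall.measurableSet).2
      (integrableOn_const (isCompact_closedBall _ _).measure_lt_top.ne)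
  · refine Eventually.of_forall fun x => ?_
    by_cases hx : x ∈ Metric.closedBall (0 : EuclideanSpace ℝ (Fin n)) 1
    · have hlim : Tendsto (fun j => Real.exp (s j) • x) atTop
          (𝓝[Metric.closedBall 0 R] (Real.exp s₀ • x)) :=
        tendsto_nhdsWithin_iff.2 ⟨hse.smul_const x,
          hsR.mono fun j hj => hball (Real.exp_pos _).le hj hx⟩
      have hmem := hball (Real.exp_pos s₀).le (by linarith) hx
      refine (hΦ.tendsto _).comp (tendsto_const_nhds.prodMk_nhds
        ((hse2.mul ?_).prodMk_nhds (hse1.smul ?_)))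
      · exact (hwv R).1.tendstoLocallyUniformlyOn.tendsto_comp hv.continuous.continuousWithinAt
          hmem hlim
      · exact (hwv R).2.tendstoLocallyUniformlyOn.tendsto_comp hcv.continuousWithinAt
          hmem hlim
    · simp only [h0 _ _ _ hx]
      exact tendsto_const_nhds

theorem continuous_cutoff : Continuous (cutoff (n := n)) := locallyLipschitz_cutoff.continuous

theorem tendsto_weissEnergy_dilate
    {w : ℕ → EuclideanSpace ℝ (Fin n) → ℝ} {v : EuclideanSpace ℝ (Fin n) → ℝ}
    (hwv : TendstoC1Loc w v) (hw : ∀ j, ContDiff ℝ 1 (w j)) (hv : ContDiff ℝ 1 v) (s : ℝ) :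
    Tendsto (fun j => weissEnergy (dilate s (w j))) atTop (𝓝 (weissEnergy (dilate s v))) := by
  have hc := continuous_cutoff (n := n)
  refine tendsto_integral_dilate (Φ := fun z => energyDensity z.1 z.2.1 z.2.2) ?_ ?_ hwv hw hv
    tendsto_const_nhds
  · unfold energyDensity
    fun_prop
  · intro x y l hx
    simp [energyDensity, cutoff_eq_zero hx]

theorem tendsto_defect_dilate
    {w : ℕ → EuclideanSpace ℝ (Fin n) → ℝ} {v : EuclideanSpace ℝ (Fin n) → ℝ}
    (hwv : TendstoC1Loc w v) (hw : ∀ j, ContDiff ℝ 1 (w j)) (hv : ContDiff ℝ 1 v)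
    {s : ℕ → ℝ} {s₀ : ℝ} (hs : Tendsto s atTop (𝓝 s₀)) :
    Tendsto (fun j => defect (dilate (s j) (w j))) atTop (𝓝 (defect (dilate s₀ v))) := by
  have hc := continuous_cutoff (n := n)
  refine tendsto_integral_dilate (Φ := fun z => defectDensity z.1 z.2.1 z.2.2) ?_ ?_ hwv hw hv hs
  · unfold defectDensity
    fun_prop
  · intro x y l hx
    simp [defectDensity, cutoff_eq_zero hx]

/-! ### From zero defect to homogeneity. -/

/-- A continuous nonnegative integrand with zero integral vanishes, and p > 0 inside the unit ball.
-/
theorem fderiv_apply_self_eq_of_defect_eq_zero {v : EuclideanSpace ℝ (Fin n) → ℝ}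
    (hv : ContDiff ℝ 1 v) (h : defect v = 0) {x : EuclideanSpace ℝ (Fin n)} (hx : ‖x‖ < 1) :
    fderiv ℝ v x x = 2 * v x := by
  have hc := continuous_cutoff (n := n)
  have hv0 := hv.continuous
  have hv1 := hv.continuous_fderiv one_ne_zero
  have hcont : Continuous fun x => defectDensity x (v x) (fderiv ℝ v x) := by
    unfold defectDensity
    fun_prop
  have hsupp : HasCompactSupport fun x => defectDensity x (v x) (fderiv ℝ v x) :=
    HasCompactSupport.intro (isCompact_closedBall 0 1) fun x hx => by
      simp [defectDensity, cutoff_eq_zero hx]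
  have hz : defectDensity x (v x) (fderiv ℝ v x) = 0 := by
    by_contra hne
    exact (hcont.integral_pos_of_hasCompactSupport_nonneg_nonzero hsupp
      (fun y => mul_nonneg (by positivity) (cutoff_nonneg y)) hne).ne' h
  have hp := (cutoff_pos hx).ne'
  rw [defectDensity] at hz
  have : fderiv ℝ v x x - 2 * v x = 0 := by simpa [hp] using hz
  linarith

/-- Euler's equation says that t ↦ e^{-2t} v(e^t x) has zero derivative; compare t = log λ with t =
0. -/
theorem isHomogeneousDegTwo_of_fderiv_apply_self {v : EuclideanSpace ℝ (Fin n) → ℝ}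
    (hv : Differentiable ℝ v) (h : ∀ x, fderiv ℝ v x x = 2 * v x) : IsHomogeneousDegTwo v := by
  intro x lam hlam
  have hder : ∀ t, HasDerivAt (fun t => dilate t v x) 0 t := by
    intro t
    have h1 : HasDerivAt (fun t : ℝ => Real.exp t • x) (Real.exp t • x) t :=
      (Real.hasDerivAt_exp t).smul_const x
    have h2 : HasDerivAt (fun t => v (Real.exp t • x)) (fderiv ℝ v (Real.exp t • x)
      (Real.exp t • x)) t := (hv _).hasFDerivAt.comp_hasDerivAt t h1
    have h3 : HasDerivAt (fun t : ℝ => Real.exp (-2 * t)) (Real.exp (-2 * t) * -2) t := by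
      simpa using ((hasDerivAt_id t).const_mul (-2)).exp
    refine (h3.mul h2).congr_deriv ?_
    rw [h]
    ring
  have hconst := is_const_of_deriv_eq_zero (fun t => (hder t).differentiableAt)
    (fun t => (hder t).deriv) (Real.log lam) 0
  have he : Real.exp (-2 * Real.log lam) * lam ^ 2 = 1 := by
    rw [← Real.exp_log (pow_pos hlam 2), Real.log_pow, ← Real.exp_add]
    simp
  simp only [dilate, Real.exp_log hlam, mul_zero, Real.exp_zero, one_smul, one_mul] at hconst
  linear_combination (lam ^ 2) * hconst - v (lam • x) * he

/-- For fixed k, c + τ_j ≤ d + τ_k once j is large; let j → ∞, then k → ∞. As c and d are arbitrary,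
swapping them gives equality of the limits. -/
theorem le_of_tendsto_of_monotone_atBot {g : ℝ → ℝ} (hg : Monotone g) {τ : ℕ → ℝ} {c d A B : ℝ}
    (hτ : Tendsto τ atTop atBot) (hA : Tendsto (fun j => g (c + τ j)) atTop (𝓝 A))
    (hB : Tendsto (fun j => g (d + τ j)) atTop (𝓝 B)) : A ≤ B := by
  refine ge_of_tendsto hB (Eventually.of_forall fun k => le_of_tendsto hA ?_)
  filter_upwards [hτ.eventually (eventually_le_atBot (d + τ k - c))] with j hj
  exact hg (by linarith)

theorem le_of_tendsto_of_monotone_atTop {g : ℝ → ℝ} (hg : Monotone g) {τ : ℕ → ℝ} {c d A B : ℝ}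
    (hτ : Tendsto τ atTop atTop) (hA : Tendsto (fun j => g (c + τ j)) atTop (𝓝 A))
    (hB : Tendsto (fun j => g (d + τ j)) atTop (𝓝 B)) : A ≤ B := by
  refine le_of_tendsto hA (Eventually.of_forall fun k => ge_of_tendsto hB ?_)
  filter_upwards [hτ.eventually (eventually_ge_atTop (c + τ k - d))] with j hj
  exact hg (by linarith)

/-- A limit of dilations along which the Weiss energy has the same limits at all scales is
homogeneous. -/
theorem isHomogeneousDegTwo_of_tendsto {u v : EuclideanSpace ℝ (Fin n) → ℝ} (hu : IsC11Loc u)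
    (hq : ∀ᵐ x, (1 - (Δ u) x) * (fderiv ℝ u x x - 2 * u x) = 0) (hv : ContDiff ℝ 1 v)
    {τ : ℕ → ℝ} (hτ : Tendsto τ atTop atBot ∨ Tendsto τ atTop atTop)
    (h : TendstoC1Loc (fun j => dilate (τ j) u) v) : IsHomogeneousDegTwo v := by
  have hvd := hv.differentiable one_ne_zero
  refine isHomogeneousDegTwo_of_fderiv_apply_self hvd fun x => ?_
  -- At any scale s ≥ c, the unit ball seen by the defect corresponds to a ball of radius e^s
  -- containing x.
  obtain ⟨c, hc⟩ : ∃ c, ‖x‖ < Real.exp c := by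
    exact ⟨‖x‖, by linarith [Real.add_one_le_exp ‖x‖]⟩
  have hw : ∀ j, ContDiff ℝ 1 (dilate (τ j) u) := fun j => (hu.dilate _).1
  set g : ℝ → ℝ := fun t => weissEnergy (dilate t u) with hg
  have hmono : Monotone g := monotone_weissEnergy_dilate hu hq
  have hlim : ∀ s, Tendsto (fun j => g (s + τ j)) atTop (𝓝 (weissEnergy (dilate s v))) := by
    intro s
    simpa only [hg, dilate_add] using tendsto_weissEnergy_dilate h hw hv s
  have hle : ∀ s s', weissEnergy (dilate s v) ≤ weissEnergy (dilate s' v) := fun s s' =>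
    hτ.elim (fun h => le_of_tendsto_of_monotone_atBot hmono h (hlim s) (hlim s'))
      (fun h => le_of_tendsto_of_monotone_atTop hmono h (hlim s) (hlim s'))
  have hdiff : Tendsto (fun j => g (c + 1 + τ j) - g (c + τ j)) atTop (𝓝 0) := by
    simpa [le_antisymm (hle (c + 1) c) (hle c (c + 1))] using (hlim (c + 1)).sub (hlim c)
  -- The derivative formula is available for u, not for the limit v, so the small defect is found
  -- along the sequence and then passed to v.
  have hmvt : ∀ j, ∃ s ∈ Icc c (c + 1),
      defect (dilate s (dilate (τ j) u)) = g (c + 1 + τ j) - g (c + τ j) := by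
    intro j
    obtain ⟨s, hs, hs'⟩ := exists_hasDerivAt_eq_slope (fun s => g (s + τ j))
      (fun s => defect (dilate (s + τ j) u)) (lt_add_one c)
      (fun s _ => ((hasDerivAt_weissEnergy_dilate hu hq (s + τ j)).comp_add_const s
        (τ j)).continuousAt.continuousWithinAt)
      (fun s _ => (hasDerivAt_weissEnergy_dilate hu hq (s + τ j)).comp_add_const s (τ j))
    refine ⟨s, Ioo_subset_Icc_self hs, ?_⟩
    rw [← dilate_add, hs']
    simp
  choose s hs hs' using hmvt
  obtain ⟨s₀, hs₀, k, hk, hks⟩ := isCompact_Icc.tendsto_subseq hs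
  have h1 := tendsto_defect_dilate (h.subseq hk) (fun j => hw (k j)) hv hks
  have hdef : defect (dilate s₀ v) = 0 := by
    refine tendsto_nhds_unique h1 ((hdiff.comp hk.tendsto_atTop).congr fun j => ?_)
    exact (hs' (k j)).symm
  have hcont : ContDiff ℝ 1 (dilate s₀ v) := contDiff_const.mul (hv.comp (contDiff_const_smul _))
  have hx : ‖Real.exp (-s₀) • x‖ < 1 := by
    rw [norm_smul, Real.norm_of_nonneg (Real.exp_pos _).le, Real.exp_neg,
      inv_mul_lt_iff₀ (Real.exp_pos _), mul_one]
    exact hc.trans_le (Real.exp_le_exp.2 hs₀.1)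
  have h2 := fderiv_apply_self_eq_of_defect_eq_zero hcont hdef hx
  have h3 := fderiv_dilate_apply_self hvd s₀ (Real.exp (-s₀) • x)
  rw [h2, sub_self, smul_smul, ← Real.exp_add, add_neg_cancel, Real.exp_zero, one_smul] at h3
  have := (mul_eq_zero.1 h3.symm).resolve_left (Real.exp_pos _).ne'
  linarith

/-! ### The obstacle problem. -/

theorem rescale_zero_eq_dilate {u : EuclideanSpace ℝ (Fin n) → ℝ} (h0 : u 0 = 0) {lam : ℝ}
    (hlam : 0 < lam) : rescale u 0 lam = dilate (Real.log lam) u := by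
  have he : Real.exp (-2 * Real.log lam) = (lam ^ 2)⁻¹ := by
    rw [← Real.exp_log (pow_pos hlam 2), Real.log_pow, ← Real.exp_neg]
    congr 1
    push_cast
    ring
  funext x
  rw [rescale, dilate, h0, zero_add, Real.exp_log hlam, he]
  ring

theorem fderiv_halfSpaceObstacle_apply_self [NeZero n] (a : ℝ) (x : EuclideanSpace ℝ (Fin n)) :
    fderiv ℝ (halfSpaceObstacle a) x x = 2 * halfSpaceObstacle a x := by
  have h1 : HasFDerivAt (fun y : EuclideanSpace ℝ (Fin n) => y 0)
      (EuclideanSpace.proj (0 : Fin n) : EuclideanSpace ℝ (Fin n) →L[ℝ] ℝ) x :=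
    (EuclideanSpace.proj (0 : Fin n) : EuclideanSpace ℝ (Fin n) →L[ℝ] ℝ).hasFDerivAt
  have h2 := ((hasDerivAt_max_zero_sq (x 0)).comp_hasFDerivAt x h1).const_mul (a / 2)
  rw [show fderiv ℝ (halfSpaceObstacle a) x = _ from h2.fderiv]
  have h3 : max (x 0) 0 * x 0 = max (x 0) 0 ^ 2 := by
    rcases le_total (x 0) 0 with h | h
    · simp [max_eq_right h]
    · rw [max_eq_left h, sq]
  simp only [smul_apply, smul_eq_mul, halfSpaceObstacle]
  change a / 2 * (2 * max (x 0) 0 * x 0) = _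
  linear_combination a * h3

theorem halfSpaceObstacle_nonneg [NeZero n] {a : ℝ} (ha : 0 ≤ a) (x : EuclideanSpace ℝ (Fin n)) :
    0 ≤ halfSpaceObstacle a x := by
  unfold halfSpaceObstacle
  positivity

/-- The two forms of the equation are compatible only where the solution is nonnegative. -/
theorem IsGlobalSolution.nonneg {a M : ℝ} {ψ u : EuclideanSpace ℝ (Fin n) → ℝ}
    (hu : IsGlobalSolution a M ψ u) (hψ : ∀ x, 0 ≤ ψ x)
    (heq : ∀ᵐ x, (Δ u) x = chi {y | 0 < u y ∧ u y < ψ y} x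
      + (Δ ψ) x * chi {y | 0 < u y ∧ u y = ψ y} x) (x : EuclideanSpace ℝ (Fin n)) : 0 ≤ u x := by
  have hopen : IsOpen {x | u x < 0} := isOpen_lt hu.regular.1.continuous continuous_const
  have hnull : volume {x | u x < 0} = 0 := by
    have : ∀ᵐ x, ¬ u x < 0 := by
      filter_upwards [hu.equation, heq] with y h1 h2 hy
      have hlt : u y < ψ y := hy.trans_le (hψ y)
      have hOm : y ∈ Omega u := fun h => hy.ne h.1
      -- Where u < 0 ≤ ψ, the first equation gives Δu = 1 and the second gives Δu = 0.
      rw [h1] at h2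
      simp [chi, hOm, hlt, hlt.ne, hy.le.not_gt] at h2
    simpa [ae_iff] using this
  by_contra hx
  have : x ∈ {x | u x < 0} := not_le.1 hx
  rw [(hopen.measure_eq_zero_iff volume).1 hnull] at this
  exact this

/-- Where a global solution is not a unit source, its homogeneity defect vanishes. -/
theorem IsGlobalSolution.defect_mul_eq_zero {a M : ℝ} {ψ u : EuclideanSpace ℝ (Fin n) → ℝ}
    (hu : IsGlobalSolution a M ψ u) (h0 : ∀ x, 0 ≤ u x)
    (hψ : ∀ x, fderiv ℝ ψ x x = 2 * ψ x) :
    ∀ᵐ x, (1 - (Δ u) x) * (fderiv ℝ u x x - 2 * u x) = 0 := by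
  have hud := hu.regular.1.differentiable one_ne_zero
  have hψd := hu.obstacle_regular.1.differentiable one_ne_zero
  filter_upwards [hu.equation] with x hx
  rcases (h0 x).eq_or_lt with h | h
  · have hmin : IsLocalMin u x := Eventually.of_forall fun y => h ▸ h0 y
    simp [hmin.fderiv_eq_zero, ← h]
  -- At a contact point ψ - u is minimal, so u inherits Euler's equation from ψ; off contact, u > 0
  -- and the source is 1.
  rcases (hu.le_obstacle x).eq_or_lt with h' | h'
  · have hmin : IsLocalMin (ψ - u) x := Eventually.of_forall fun y => by
      simpa [h'] using hu.le_obstacle y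
    have := hmin.fderiv_eq_zero
    rw [fderiv_sub (hψd x) (hud x), sub_eq_zero] at this
    rw [← this, hψ, h', sub_self, mul_zero]
  · have hOm : x ∈ Omega u := fun hm => h.ne' hm.1
    simp [hx, chi, hOm, h', h'.ne]

theorem isHomogeneousDegTwo_of_rescale {u v : EuclideanSpace ℝ (Fin n) → ℝ} (hu : IsC11Loc u)
    (h0 : u 0 = 0) (hq : ∀ᵐ x, (1 - (Δ u) x) * (fderiv ℝ u x x - 2 * u x) = 0)
    (hv : IsC11Loc v) {lam : ℕ → ℝ} (hpos : ∀ j, 0 < lam j)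
    (hlam : Tendsto lam atTop (𝓝 0) ∨ Tendsto lam atTop atTop)
    (h : ∀ α : ℝ≥0, 0 < α → α < 1 → TendstoC1HolderLoc α (fun j => rescale u 0 (lam j)) v) :
    IsHomogeneousDegTwo v := by
  -- Only C¹ convergence is needed, so any one exponent serves.
  have hlim := h (1 / 2) (by simp) one_half_lt_one
  simp only [rescale_zero_eq_dilate h0 (hpos _)] at hlim
  refine isHomogeneousDegTwo_of_tendsto hu hq hv.1 (hlam.imp (fun h => ?_) fun h => ?_)
    (hlim.tendstoC1Loc (fun j => (hu.dilate _).1.differentiable one_ne_zero)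
      (hv.1.differentiable one_ne_zero))
  · exact Real.tendsto_log_nhdsGT_zero.comp
      (tendsto_nhdsWithin_iff.2 ⟨h, Eventually.of_forall hpos⟩)
  · exact Real.tendsto_log_atTop.comp h

end DoubleObstacle

theorem corollary3p9 {n : ℕ} [NeZero n] (hn : 2 ≤ n) (a M : ℝ)
    (u : EuclideanSpace ℝ (Fin n) → ℝ)
    (hu : DoubleObstacle.IsGlobalSolution a M (DoubleObstacle.halfSpaceObstacle a) u)
    (heq : ∀ᵐ x, (Δ u) x =
      DoubleObstacle.chi
          {y | 0 < u y ∧ u y < DoubleObstacle.halfSpaceObstacle a y} x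
        + (Δ (DoubleObstacle.halfSpaceObstacle a)) x *
          DoubleObstacle.chi
            {y | 0 < u y ∧ u y = DoubleObstacle.halfSpaceObstacle a y} x) :
    (∀ u₀ : EuclideanSpace ℝ (Fin n) → ℝ,
        DoubleObstacle.IsBlowup u 0 u₀ → DoubleObstacle.IsHomogeneousDegTwo u₀) ∧
    (∀ uInf : EuclideanSpace ℝ (Fin n) → ℝ,
        DoubleObstacle.IsShrinkDown u 0 uInf → DoubleObstacle.IsHomogeneousDegTwo uInf) := by
  have hnonneg := hu.nonneg
    (DoubleObstacle.halfSpaceObstacle_nonneg (zero_le_one.trans hu.one_lt.le)) heq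
  have hq := hu.defect_mul_eq_zero hnonneg (DoubleObstacle.fderiv_halfSpaceObstacle_apply_self a)
  -- Squeezed: 0 ≤ u(0) ≤ ψ(0) = 0.
  have h0 : u 0 = 0 := le_antisymm
    (by simpa [DoubleObstacle.halfSpaceObstacle] using hu.le_obstacle 0) (hnonneg 0)
  constructor
  · rintro v ⟨hv, lam, hpos, hlam, h⟩
    exact DoubleObstacle.isHomogeneousDegTwo_of_rescale hu.regular h0 hq hv hpos (Or.inl hlam) h
  · rintro v ⟨hv, lam, hpos, hlam, h⟩
    exact DoubleObstacle.isHomogeneousDegTwo_of_rescale hu.regular h0 hq hv hpos (Or.inr hlam) h
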